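/- Let $\mu$ be a noise measure on $\mathbb R^2$: a compactly supported Borel probability measure with mean zero that is preserved by every orthogonal transformation fixing $\mathbf e_1$. Assume $C_{22}=\int x_2^2\,d\mu>0$, so that $p=p(\mu)=(C_{11}+C_{22}+1)/C_{22}$, where $C$ is the covariance matrix of $\mu$, is a number in $(1,\infty)$. Put $\alpha=1+\inf\{R:\mu(B_R(0))=1\}$, where $B_R(0)$ is the open ball. For $v\in\mathbb R^2$ let $\mu_v(B)=\mu(\Psi^{-1}(B))$, where $\Psi$ is $|v|$ times an orthogonal transformation with $\Psi(\mathbf e_1)=v$ (the choice of $\Psi$ does not matter). For a domain $D\subsetneq\mathbb R^2$ and $\varepsilon>0$, the tug-of-war with noise $\mu$ and step size $\varepsilon$ is played as follows from $x_0\in D$. At turn $k$ a fair coin is tossed. If $\operatorname{dist}(x_{k-1},\partial D)>\alpha\varepsilon$, the winning player chooses $v_k$ with $|v_k|\le\varepsilon$ and the position moves to $x_k=x_{k-1}+v_k+z_k$ with $z_k$ sampled from $\mu_{v_k}$. If $\operatorname{dist}(x_{k-1},\partial D)\le\alpha\varepsilon$, the winning player chooses $x_k\in\partial D$ with $|x_k-x_{k-1}|\le\alpha\varepsilon$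 and the game ends. A strategy of a player (for step size $\varepsilon$) makes these choices by Borel functions of the game history $(x_0,v_1,x_1,\dots,v_{k-1},x_{k-1})$. A pair of strategies and the starting point $x_0$ determine the law of the infinite history; $E_{x_0}$ is its expectation, and $\tau\in\{0,1,2,\dots\}\cup\{\infty\}$, the time to end the game, is the first $k$ with $x_k\in\partial D$. **Corollary.** Let $A>0$, $0<\gamma<1$ and $D=D_{A,\gamma}=\{(x,y)\in\mathbb R^2: x>0,\ |y|<Ax^\gamma\}$. There are $\varepsilon_0>0$ and a strategy of player II (that is, one strategy for each step size $\varepsilon\in(0,\varepsilon_0)$), neither depending on $x_0$, such that for every $x_0\in D_{A,\gamma}$ $$\sup_{S_I}\ \sup_{0<\varepsilon<\varepsilon_0}\ \varepsilon^2E_{x_0}[\tau]<\infty ,$$ where the first supremum is over all strategies $S_I$ of player I (again one for each step size) and $\tau$ is the time to end the game in $D_{A,\gamma}$. -/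

import Mathlib

open MeasureTheory ProbabilityTheory
open scoped ENNReal

noncomputable section

namespace TugOfWar

/-- The plane with its Euclidean norm. -/
abbrev Plane : Type := EuclideanSpace ℝ (Fin 2)

/-- The first basis vector. -/
def e₁ : Plane := !₂[1, 0]

/-- A noise measure (on the plane): a compactly supported Borel probability measure (the total mass
is the instance argument) with mean zero, preserved by the orthogonal transformations that fix the
first basis vector. -/
structure IsNoiseMeasure (μ : Measure Plane) [IsProbabilityMeasure μ] : Prop where
  compact_support : ∃ K : Set Plane, IsCompact K ∧ μ Kᶜ = 0
  mean_zero : ∫ x, x ∂μ = 0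
  invariant : ∀ L : Plane ≃ₗᵢ[ℝ] Plane, L e₁ = e₁ → μ.map L = μ

/-- The entry `C i j` of the covariance matrix of a mean zero measure. -/
def cov (μ : Measure Plane) (i j : Fin 2) : ℝ := ∫ x, x i * x j ∂μ

/-- `α = 1 + inf {R : μ (B_R(0)) = 1}`, with open balls. -/
def alpha (μ : Measure Plane) : ℝ := 1 + sInf {R : ℝ | μ (Metric.ball 0 R) = 1}

/-- The linear map `Ψ` with matrix `[[v₀, -v₁], [v₁, v₀]]`: it is `|v|` times a rotation and maps
the first basis vector to `v`. -/
def Psi (v w : Plane) : Plane := w 0 • v + w 1 • !₂[-v 1, v 0]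

/-- The scaled and rotated noise `μ_v (B) = μ (Ψ⁻¹ (B))`. For a noise measure `μ`, the image of `μ`
is the same for every other choice of `Ψ` as `|v|` times an orthogonal map with `Ψ e₁ = v`. -/
def noiseAt (μ : Measure Plane) (v : Plane) : Measure Plane := μ.map (Psi v)

/-- A game history up to step `n`. The entry with index `k` is the pair `(v_k, x_k)` of the `k`-th
move and the `k`-th game position; the entry with index `0` is `(0, x_0)`. -/
abbrev History (n : ℕ) : Type := (i : Finset.Iic n) → Plane × Plane

/-- The current game position `x_n` in a history up to step `n`. -/
def History.pos {n : ℕ} (h : History n) : Plane := (h ⟨n, Finset.mem_Iic.2 le_rfl⟩).2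

/-- A complete history `(x_0, v_1, x_1, v_2, x_2, …)`, in the same encoding. -/
abbrev CompleteHistory : Type := (n : ℕ) → Plane × Plane

/-- A strategy for a player in the game in `D` with noise `μ` and step size `ε`. The Borel map
`move n` gives the vector that the player adds to the game position in turn `n + 1` when this player
wins the toss at distance more than `α ε` from the boundary, as a function of the history; the
Borel map `exit n` gives the boundary point that the player selects when this player wins the toss
at distance at most `α ε` from the boundary. -/
structure Strategy (D : TopologicalSpace.Opens Plane) (μ : Measure Plane) (ε : ℝ) where
  move : (n : ℕ) → History n → Plane
  measurable_move : ∀ n, Measurable (move n)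
  norm_move_le : ∀ n h, ‖move n h‖ ≤ ε
  exit : (n : ℕ) → History n → Plane
  measurable_exit : ∀ n, Measurable (exit n)
  exit_mem : ∀ n (h : History n), h.pos ∈ D →
    Metric.infDist h.pos (frontier (D : Set Plane)) ≤ alpha μ * ε →
    exit n h ∈ frontier (D : Set Plane) ∧ dist (exit n h) h.pos ≤ alpha μ * ε

variable {D : TopologicalSpace.Opens Plane} {μ : Measure Plane} {ε : ℝ}

open scoped Classical in
/-- The law of the next entry `(v_{n+1}, x_{n+1})` given the history `h` up to step `n`, if the
player with strategy `S` wins the toss in turn `n + 1`. If the game is over, the position is kept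
and the recorded move is `0`; in the turn that ends the game the recorded move is `0` as well. -/
def Strategy.turn (S : Strategy D μ ε) (n : ℕ) (h : History n) : Measure (Plane × Plane) :=
  if h.pos ∈ D then
    if Metric.infDist h.pos (frontier (D : Set Plane)) ≤ alpha μ * ε then
      Measure.dirac (0, S.exit n h)
    else
      (noiseAt μ (S.move n h)).map (fun z => (S.move n h, h.pos + S.move n h + z))
  else Measure.dirac (0, h.pos)

/-- The law of the next entry of the history: a fair coin decides who wins the turn. -/
def turnMeasure (S₁ S₂ : Strategy D μ ε) (n : ℕ) (h : History n) : Measure (Plane × Plane) :=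
  (2⁻¹ : ℝ≥0∞) • S₁.turn n h + (2⁻¹ : ℝ≥0∞) • S₂.turn n h

lemma measurable_pos (n : ℕ) : Measurable (History.pos (n := n)) := by
  unfold History.pos
  fun_prop

lemma measurable_Psi : Measurable (fun p : Plane × Plane => Psi p.1 p.2) := by
  unfold Psi
  refine Continuous.measurable ?_
  fun_prop

lemma measurable_map_of_measurable_uncurry {X Y Z : Type*} [MeasurableSpace X] [MeasurableSpace Y]
    [MeasurableSpace Z] (ν : Measure Y) [SFinite ν] {f : X → Y → Z}
    (hf : Measurable (Function.uncurry f)) : Measurable (fun x => ν.map (f x)) := by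
  refine Measure.measurable_of_measurable_coe _ fun s hs => ?_
  have h : ∀ x, ν.map (f x) s = ν (Prod.mk x ⁻¹' (Function.uncurry f ⁻¹' s)) := fun x =>
    Measure.map_apply (hf.comp measurable_prodMk_left) hs
  simp_rw [h]
  exact measurable_measure_prodMk_left (hf hs)

lemma map_noiseAt (v x : Plane) :
    (noiseAt μ v).map (fun z => (v, x + v + z)) = μ.map (fun w => (v, x + v + Psi v w)) := by
  have h : Measurable (Psi v) := measurable_Psi.comp measurable_prodMk_left
  rw [noiseAt, Measure.map_map (by fun_prop) h]
  rfl

lemma measurable_turn [IsProbabilityMeasure μ] (S : Strategy D μ ε) (n : ℕ) :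
    Measurable (S.turn n) := by
  have hp := measurable_pos n
  have hm := S.measurable_move n
  have he := S.measurable_exit n
  unfold Strategy.turn
  refine Measurable.ite (D.isOpen.measurableSet.preimage hp) (Measurable.ite ?_ ?_ ?_) ?_
  · exact measurableSet_le ((Metric.continuous_infDist_pt _).measurable.comp hp) measurable_const
  · exact Measure.measurable_dirac.comp (by fun_prop)
  · simp_rw [map_noiseAt]
    refine measurable_map_of_measurable_uncurry μ ?_
    have h1 : Measurable fun q : History n × Plane => Psi (S.move n q.1) q.2 :=
      measurable_Psi.comp ((hm.comp measurable_fst).prodMk measurable_snd)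
    exact (hm.comp measurable_fst).prodMk
      (((hp.comp measurable_fst).add (hm.comp measurable_fst)).add h1)
  · exact Measure.measurable_dirac.comp (by fun_prop)

lemma isProbabilityMeasure_turn [IsProbabilityMeasure μ] (S : Strategy D μ ε) (n : ℕ)
    (h : History n) : IsProbabilityMeasure (S.turn n h) := by
  unfold Strategy.turn
  split_ifs
  · infer_instance
  · have h1 : Measurable (Psi (S.move n h)) := measurable_Psi.comp measurable_prodMk_left
    rw [map_noiseAt]
    exact Measure.isProbabilityMeasure_map (by fun_prop)
  · infer_instance

/-- The transition kernel from the histories up to step `n` to the next entry. -/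
def step [IsProbabilityMeasure μ] (S₁ S₂ : Strategy D μ ε) (n : ℕ) :
    Kernel (History n) (Plane × Plane) where
  toFun := turnMeasure S₁ S₂ n
  measurable' := by
    refine Measure.measurable_of_measurable_coe _ fun s hs => ?_
    have h1 := (Measure.measurable_coe hs).comp (measurable_turn S₁ n)
    have h2 := (Measure.measurable_coe hs).comp (measurable_turn S₂ n)
    exact (h1.const_mul _).add (h2.const_mul _)

instance [IsProbabilityMeasure μ] (S₁ S₂ : Strategy D μ ε) (n : ℕ) :
    IsMarkovKernel (step S₁ S₂ n) where
  isProbabilityMeasure h := by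
    have h1 := isProbabilityMeasure_turn S₁ n h
    have h2 := isProbabilityMeasure_turn S₂ n h
    refine ⟨?_⟩
    change turnMeasure S₁ S₂ n h Set.univ = 1
    simp [turnMeasure, ENNReal.inv_two_add_inv_two]

/-- The law of the complete history of the game that starts at `x₀`, when player I uses `S₁` and
player II uses `S₂`: the measure which the one-turn transition kernels determine
(Ionescu-Tulcea). -/
def law [IsProbabilityMeasure μ] (S₁ S₂ : Strategy D μ ε) (x₀ : Plane) :
    Measure CompleteHistory :=
  Kernel.traj (X := fun _ => Plane × Plane) (step S₁ S₂) 0 (fun _ => (0, x₀))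

/-- The time to end the game: the first `k` with `x_k` on the boundary of `D`, and `∞` if there is
no such `k`. -/
def tau (D : TopologicalSpace.Opens Plane) (h : CompleteHistory) : ℝ≥0∞ :=
  ⨅ (k : ℕ) (_ : (h k).2 ∈ frontier (D : Set Plane)), (k : ℝ≥0∞)

/-- The expected time `E_{x₀}[τ]` to end the game. -/
def expectedTime [IsProbabilityMeasure μ] (S₁ S₂ : Strategy D μ ε) (x₀ : Plane) : ℝ≥0∞ :=
  ∫⁻ h, tau D h ∂(law S₁ S₂ x₀)

/-- The power-type domain `D_{A,γ} = {(x, y) : x > 0, |y| < A x^γ}`. -/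
def powerDomain (A γ : ℝ) : TopologicalSpace.Opens Plane where
  carrier := {z | 0 < z 0 ∧ |z 1| < A * z 0 ^ γ}
  is_open' := by
    have h0 : IsOpen {z : Plane | 0 < z 0} := isOpen_lt continuous_const (by fun_prop)
    have h1 : ContinuousOn (fun z : Plane => A * z 0 ^ γ - |z 1|) {z : Plane | 0 < z 0} := by
      refine ContinuousOn.sub (continuousOn_const.mul ?_) (by fun_prop)
      exact ContinuousOn.rpow_const (by fun_prop) fun z hz => Or.inl (ne_of_gt hz)
    have h2 := h1.isOpen_inter_preimage h0 isOpen_Ioi (t := Set.Ioi (0 : ℝ))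
    convert h2 using 1
    ext z
    simp [sub_pos]

end TugOfWar

end

open MeasureTheory ProbabilityTheory
open scoped ENNReal

noncomputable section

namespace TugOfWar

variable {D : TopologicalSpace.Opens Plane} {μ : Measure Plane} {ε : ℝ}

/-! ### Expected duration from a Lyapunov function -/

section

/-! The quadratic `u = (x + N)^2 - B y^2` serves as a Lyapunov function. Its mean change under a
move `v` is exactly `⟨∇u, v⟩` plus a quadratic form in `v`. Noise along the move contributes through
`C₁₁`, noise across it through `C₂₂`; as `C₂₂ > 0`, a large `B` makes the form at most `-|v|^2` in
every direction (`integral_potential_le`). Player II makes a full step against `∇u`, which offsets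
any first-order gain of player I, so `u` falls by at least `ε^2 / 2` per turn on average
(`barrier_drift`).

Because `γ < 1`, the curve `√B A x^γ` lies below `x + N` for large `N`, so `u ≥ 0` on the domain
(`exists_potential_nonneg`). A nonnegative quantity with such a drift bounds the duration
(`expectedTime_le_of_drift`): `ε^2 E[τ] ≤ 2 u(x₀) + ε^2`, whatever player I does. -/

lemma tau_le_tsum (D : TopologicalSpace.Opens Plane) (h : CompleteHistory) :
    tau D h ≤ ∑' k, (frontier (D : Set Plane))ᶜ.indicator (fun _ => (1 : ℝ≥0∞)) (h k).2 := by
  classical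
  by_cases hF : ∃ k, (h k).2 ∈ frontier (D : Set Plane)
  · calc tau D h ≤ (Nat.find hF : ℝ≥0∞) := iInf₂_le (Nat.find hF) (Nat.find_spec hF)
      _ = ∑ k ∈ Finset.range (Nat.find hF),
          (frontier (D : Set Plane))ᶜ.indicator (fun _ => (1 : ℝ≥0∞)) (h k).2 := by
        rw [Finset.sum_congr rfl fun k hk => Set.indicator_of_mem
          (show (h k).2 ∈ (frontier (D : Set Plane))ᶜ from
            Nat.find_min hF (Finset.mem_range.1 hk)) _]
        simp
      _ ≤ _ := ENNReal.sum_le_tsum _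
  -- If the game never ends, the sum of indicators diverges, matching `tau = ⊤`.
  · push Not at hF
    have h1 : ∀ k, (frontier (D : Set Plane))ᶜ.indicator (fun _ => (1 : ℝ≥0∞)) (h k).2 = 1 :=
      fun k => Set.indicator_of_mem (show (h k).2 ∈ (frontier (D : Set Plane))ᶜ from hF k) _
    simp_rw [h1]
    rw [ENNReal.tsum_const_eq_top_of_ne_zero one_ne_zero]
    exact le_top

variable [IsProbabilityMeasure μ]

lemma lintegral_law_succ (S₁ S₂ : Strategy D μ ε) (x₀ : Plane) (n : ℕ)
    {f : Plane × Plane → ℝ≥0∞} (hf : Measurable f) :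
    ∫⁻ h, f (h (n + 1)) ∂(law S₁ S₂ x₀) =
      ∫⁻ h, ∫⁻ z, f z ∂(turnMeasure S₁ S₂ n (Preorder.frestrictLe n h)) ∂(law S₁ S₂ x₀) := by
  have hg : Measurable fun h : History n => ∫⁻ z, f z ∂(turnMeasure S₁ S₂ n h) :=
    (Measure.measurable_lintegral hf).comp (step S₁ S₂ n).measurable
  have h1 := lintegral_map (μ := law S₁ S₂ x₀) hg (Preorder.measurable_frestrictLe n)
  rw [← h1]
  unfold law
  rw [Kernel.traj_map_frestrictLe_apply]
  rw [← Kernel.traj_comp_partialTraj (Nat.zero_le n)]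
  rw [Kernel.lintegral_comp (g := fun h : CompleteHistory => f (h (n + 1))) _ _ _
    (hf.comp (measurable_pi_apply (n + 1)))]
  congr 1 with h
  rw [← lintegral_map (f := f) (g := fun h : CompleteHistory => h (n + 1)) hf
    (measurable_pi_apply _),
    ← Kernel.map_apply _ (measurable_pi_apply _), Kernel.map_traj_succ_self]
  rfl

/-- Each turn begun off the frontier costs `c` out of the mean of `W`; the costs telescope, and the
remaining mean is nonnegative and can be dropped. -/
lemma expectedTime_le_of_drift (S₁ S₂ : Strategy D μ ε) (x₀ : Plane) {W : Plane → ℝ≥0∞}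
    (hW : Measurable W) (c : ℝ≥0∞)
    (hdrift : ∀ n (h : History n), ∫⁻ z, W z.2 ∂(turnMeasure S₁ S₂ n h) +
      c * (frontier (D : Set Plane))ᶜ.indicator (fun _ => (1 : ℝ≥0∞)) h.pos ≤ W h.pos) :
    c * expectedTime S₁ S₂ x₀ ≤ W x₀ := by
  set I : Plane → ℝ≥0∞ := (frontier (D : Set Plane))ᶜ.indicator (fun _ => (1 : ℝ≥0∞)) with hI
  have hIm : Measurable I := measurable_const.indicator isClosed_frontier.measurableSet.compl
  have hIk : ∀ k, Measurable fun h : CompleteHistory => I (h k).2 := fun k =>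
    hIm.comp (measurable_snd.comp (measurable_pi_apply k))
  have hzero : ∫⁻ h, W (h 0).2 ∂(law S₁ S₂ x₀) = W x₀ := by
    have h1 := lintegral_map (μ := law S₁ S₂ x₀)
      (hW.comp (measurable_pos 0)) (Preorder.measurable_frestrictLe 0)
    have h2 : (law S₁ S₂ x₀).map (Preorder.frestrictLe 0) =
        Measure.dirac (fun _ => (0, x₀)) := by
      unfold law
      rw [Kernel.traj_map_frestrictLe_apply, Kernel.partialTraj_self, Kernel.id_apply]
    rw [h2, lintegral_dirac' _ (hW.comp (measurable_pos 0))] at h1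
    exact h1.symm
  have hstep : ∀ n, ∫⁻ h, W (h (n + 1)).2 ∂(law S₁ S₂ x₀) +
      c * ∫⁻ h, I (h n).2 ∂(law S₁ S₂ x₀) ≤ ∫⁻ h, W (h n).2 ∂(law S₁ S₂ x₀) := by
    intro n
    rw [lintegral_law_succ S₁ S₂ x₀ n (f := fun z => W z.2) (hW.comp measurable_snd),
      ← lintegral_const_mul _ (hIk n),
      ← lintegral_add_right _ ((hIk n).const_mul c)]
    exact lintegral_mono fun h => hdrift n (Preorder.frestrictLe n h)
  have hsum : ∀ n, ∫⁻ h, W (h n).2 ∂(law S₁ S₂ x₀) +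
      ∑ k ∈ Finset.range n, c * ∫⁻ h, I (h k).2 ∂(law S₁ S₂ x₀) ≤ W x₀ := by
    intro n
    induction n with
    | zero => simp [hzero]
    | succ n ih =>
      rw [Finset.sum_range_succ, add_comm (Finset.sum _ _), ← add_assoc]
      exact (add_le_add_left (hstep n) _).trans ih
  calc c * expectedTime S₁ S₂ x₀
      ≤ c * ∫⁻ h, ∑' k, I (h k).2 ∂(law S₁ S₂ x₀) := by
        gcongr
        exact lintegral_mono fun h => tau_le_tsum D h
    _ = ∑' k, c * ∫⁻ h, I (h k).2 ∂(law S₁ S₂ x₀) := by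
        rw [lintegral_tsum fun k => (hIk k).aemeasurable, ENNReal.tsum_mul_left]
    _ ≤ W x₀ := ENNReal.tsum_le_of_sum_range_le fun n => le_add_self.trans (hsum n)

end

/-! ### Size of a step and moments of the noise -/

section

/-- A closed ball about `p` that misses the frontier is connected, so it cannot leave `D`. -/
lemma mem_of_dist_lt_infDist_frontier {p y : Plane} (hp : p ∈ D)
    (h : dist y p < Metric.infDist p (frontier (D : Set Plane))) : y ∈ D := by
  set r := dist y p
  have hs : IsPreconnected (Metric.closedBall p r) := (convex_closedBall p r).isPreconnected
  refine hs.subset_left_of_subset_union D.isOpen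
    (isClosed_closure (s := (D : Set Plane))).isOpen_compl ?_ ?_ ⟨p, ?_, hp⟩
    (Metric.mem_closedBall.2 le_rfl)
  · exact Set.disjoint_compl_right_iff_subset.2 subset_closure
  · intro z hz
    by_cases hzD : z ∈ (D : Set Plane)
    · exact Or.inl hzD
    · refine Or.inr fun hzc => ?_
      have hzF : z ∈ frontier (D : Set Plane) := by
        rw [D.isOpen.frontier_eq]
        exact ⟨hzc, hzD⟩
      have h1 := Metric.infDist_le_dist_of_mem (x := p) hzF
      rw [dist_comm] at h1
      exact absurd (h1.trans (Metric.mem_closedBall.1 hz)) (not_le.2 h)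
  · exact Metric.mem_closedBall_self dist_nonneg

lemma norm_Psi (v w : Plane) : ‖Psi v w‖ = ‖v‖ * ‖w‖ := by
  rw [← sq_eq_sq₀ (norm_nonneg _) (by positivity), mul_pow]
  simp only [EuclideanSpace.real_norm_sq_eq, Fin.sum_univ_two, Psi, PiLp.add_apply,
    PiLp.smul_apply, smul_eq_mul, Matrix.cons_val_zero, Matrix.cons_val_one,
    Matrix.cons_val_fin_one]
  ring

lemma abs_coord_le_norm (w : Plane) (i : Fin 2) : |w i| ≤ ‖w‖ := by
  simpa using PiLp.norm_apply_le w i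

lemma setOf_ball_pos {R : ℝ} (hR : μ (Metric.ball 0 R) = 1) : 0 < R := by
  by_contra h
  rw [Metric.ball_eq_empty.2 (not_lt.1 h)] at hR
  simp at hR

lemma one_le_alpha : 1 ≤ alpha μ :=
  le_add_of_nonneg_right (Real.sInf_nonneg fun _ hR => (setOf_ball_pos hR).le)

namespace IsNoiseMeasure

variable [IsProbabilityMeasure μ]

lemma setOf_ball_nonempty (hμ : IsNoiseMeasure μ) : {R : ℝ | μ (Metric.ball 0 R) = 1}.Nonempty := by
  obtain ⟨K, hK, hK0⟩ := hμ.compact_support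
  obtain ⟨R, hR⟩ := hK.isBounded.subset_ball (0 : Plane)
  refine ⟨R, (prob_compl_eq_zero_iff Metric.isOpen_ball.measurableSet).1 ?_⟩
  exact measure_mono_null (Set.compl_subset_compl.2 hR) hK0

lemma ae_norm_le (hμ : IsNoiseMeasure μ) : ∀ᵐ w ∂μ, ‖w‖ ≤ alpha μ - 1 := by
  -- With open balls the infimum in `alpha` need not be attained, so it is approached from above.
  have h1 : ∀ n : ℕ, ∀ᵐ w ∂μ, ‖w‖ ≤ alpha μ - 1 + 1 / ((n : ℝ) + 1) := by
    intro n
    have hn : (0 : ℝ) < 1 / ((n : ℝ) + 1) := by positivity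
    obtain ⟨R, hR, hRlt⟩ := Real.lt_sInf_add_pos hμ.setOf_ball_nonempty hn
    have h2 : ∀ᵐ w ∂μ, w ∈ Metric.ball (0 : Plane) R :=
      (prob_compl_eq_zero_iff Metric.isOpen_ball.measurableSet).2 hR
    filter_upwards [h2] with w hw
    rw [mem_ball_zero_iff] at hw
    unfold alpha
    linarith
  filter_upwards [ae_all_iff.2 h1] with w hw
  have h2 := (tendsto_one_div_add_atTop_nhds_zero_nat (𝕜 := ℝ)).const_add (alpha μ - 1)
  rw [add_zero] at h2
  exact ge_of_tendsto' h2 hw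

lemma integrable_coord (hμ : IsNoiseMeasure μ) (i : Fin 2) : Integrable (fun w : Plane => w i) μ :=
  Integrable.of_bound (by fun_prop) (alpha μ - 1) <| by
    filter_upwards [hμ.ae_norm_le] with w hw
    exact (abs_coord_le_norm w i).trans hw

lemma integrable_coord_mul (hμ : IsNoiseMeasure μ) (i j : Fin 2) :
    Integrable (fun w : Plane => w i * w j) μ :=
  Integrable.of_bound (by fun_prop) ((alpha μ - 1) * (alpha μ - 1)) <| by
    filter_upwards [hμ.ae_norm_le] with w hw
    rw [norm_mul]
    exact mul_le_mul ((abs_coord_le_norm w i).trans hw) ((abs_coord_le_norm w j).trans hw)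
      (norm_nonneg _) ((norm_nonneg _).trans hw)

lemma integral_coord (hμ : IsNoiseMeasure μ) (i : Fin 2) : ∫ w, w i ∂μ = 0 := by
  have hid : Integrable (fun w : Plane => w) μ :=
    Integrable.of_bound (by fun_prop) (alpha μ - 1) hμ.ae_norm_le
  have h := (EuclideanSpace.proj (𝕜 := ℝ) i).integral_comp_comm hid
  rw [hμ.mean_zero] at h
  simpa using h

/-- The reflection in the first axis preserves `μ` and changes the sign of `w 0 * w 1`. -/
lemma cov_zero_one (hμ : IsNoiseMeasure μ) : cov μ 0 1 = 0 := by
  let L : Plane ≃ₗᵢ[ℝ] Plane := LinearIsometryEquiv.piLpCongrRight 2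
    (![LinearIsometryEquiv.refl ℝ ℝ, LinearIsometryEquiv.neg ℝ] : Fin 2 → ℝ ≃ₗᵢ[ℝ] ℝ)
  have hL0 : ∀ w, L w 0 = w 0 := fun w => by simp [L]
  have hL1 : ∀ w, L w 1 = -w 1 := fun w => by simp [L]
  have hLe : L e₁ = e₁ := by
    ext i
    fin_cases i
    · exact hL0 e₁
    · exact (hL1 e₁).trans (by simp [e₁])
  have h : cov μ 0 1 = -cov μ 0 1 := by
    conv_lhs => rw [cov, ← hμ.invariant L hLe]
    rw [integral_map L.continuous.measurable.aemeasurable (by fun_prop), cov, ← integral_neg]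
    congr 1 with w
    rw [hL0, hL1]
    ring
  linarith

lemma integral_quadratic (hμ : IsNoiseMeasure μ) (c₀ c₁ c₂ c₃ c₄ c₅ : ℝ) :
    Integrable (fun w : Plane => c₀ + c₁ * w 0 + c₂ * w 1 + c₃ * (w 0 * w 0) + c₄ * (w 1 * w 1) +
      c₅ * (w 0 * w 1)) μ ∧
    ∫ w, (c₀ + c₁ * w 0 + c₂ * w 1 + c₃ * (w 0 * w 0) + c₄ * (w 1 * w 1) +
      c₅ * (w 0 * w 1)) ∂μ = c₀ + c₃ * cov μ 0 0 + c₄ * cov μ 1 1 := by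
  have i1 : Integrable (fun w : Plane => c₀ + c₁ * w 0) μ :=
    (integrable_const _).add ((hμ.integrable_coord 0).const_mul c₁)
  have i2 : Integrable (fun w : Plane => c₀ + c₁ * w 0 + c₂ * w 1) μ :=
    i1.add ((hμ.integrable_coord 1).const_mul c₂)
  have i3 : Integrable (fun w : Plane => c₀ + c₁ * w 0 + c₂ * w 1 + c₃ * (w 0 * w 0)) μ :=
    i2.add ((hμ.integrable_coord_mul 0 0).const_mul c₃)
  have i4 : Integrable (fun w : Plane => c₀ + c₁ * w 0 + c₂ * w 1 + c₃ * (w 0 * w 0) +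
      c₄ * (w 1 * w 1)) μ :=
    i3.add ((hμ.integrable_coord_mul 1 1).const_mul c₄)
  have i5 := (hμ.integrable_coord_mul 0 1).const_mul c₅
  refine ⟨i4.add i5, ?_⟩
  rw [integral_add i4 i5, integral_add i3 ((hμ.integrable_coord_mul 1 1).const_mul c₄),
    integral_add i2 ((hμ.integrable_coord_mul 0 0).const_mul c₃),
    integral_add i1 ((hμ.integrable_coord 1).const_mul c₂),
    integral_add (integrable_const _) ((hμ.integrable_coord 0).const_mul c₁)]
  have h01 : ∫ w : Plane, w 0 * w 1 ∂μ = 0 := hμ.cov_zero_one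
  simp only [integral_const_mul, hμ.integral_coord, cov, h01]
  simp

end IsNoiseMeasure

lemma cov_self_nonneg (μ : Measure Plane) (i : Fin 2) : 0 ≤ cov μ i i :=
  integral_nonneg fun _ => mul_self_nonneg _

end

/-! ### Borel choice of the exit point -/

section

/-- A Borel choice of a point at distance at most `r` in a closed set that is contained in the graph
of a function of the second coordinate: take the lowest such point. -/
lemma exists_measurable_selection {F : Set Plane} (hF : IsClosed F) (hne : F.Nonempty) {g : ℝ → ℝ}
    (hg : Measurable g) (hFg : ∀ z ∈ F, z 0 = g (z 1)) {r : ℝ} (hr : 0 ≤ r) :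
    ∃ e : Plane → Plane, Measurable e ∧
      ∀ p, Metric.infDist p F ≤ r → e p ∈ F ∧ dist (e p) p ≤ r := by
  classical
  let T : Set Plane → Set Plane := Metric.cthickening r
  have hT : ∀ {E : Set Plane}, IsClosed E → ∀ {p}, p ∈ T E ↔ ∃ z ∈ E, dist z p ≤ r := by
    intro E hE p
    simp only [T, hE.cthickening_eq_biUnion_closedBall hr, Set.mem_iUnion, Metric.mem_closedBall,
      exists_prop, dist_comm p]
  have hTm : ∀ E, MeasurableSet (T E) := fun E => Metric.isClosed_cthickening.measurableSet
  let s : Plane → Set ℝ := fun p => (fun z : Plane => z 1) '' (F ∩ Metric.closedBall p r)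
  have hcont : Continuous fun z : Plane => z 1 := by fun_prop
  have hs : ∀ p, IsCompact (s p) := fun p =>
    ((isCompact_closedBall p r).inter_left hF).image hcont
  have hsmem : ∀ {p}, p ∈ T F → sInf (s p) ∈ s p := by
    intro p hp
    obtain ⟨z, hz, hzp⟩ := (hT hF).1 hp
    exact (hs p).sInf_mem ⟨z 1, z, ⟨hz, hzp⟩, rfl⟩
  let t : Plane → ℝ := fun p => if p ∈ T F then sInf (s p) else 0
  have ht : Measurable t := by
    refine measurable_of_Iic fun c => ?_
    have hclosed : IsClosed (F ∩ {z : Plane | z 1 ≤ c}) :=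
      hF.inter (isClosed_le hcont continuous_const)
    -- The lowest admissible height is at most `c` exactly when `F` has a point of height at most
    -- `c` within `r`, a closed condition on `p`. The second piece comes from the default value `0`
    -- of `t`.
    have heq : t ⁻¹' Set.Iic c = (T F ∩ T (F ∩ {z : Plane | z 1 ≤ c})) ∪
        ((T F)ᶜ ∩ {_p : Plane | 0 ≤ c}) := by
      ext p
      by_cases hp : p ∈ T F
      · simp only [t, hp, Set.mem_preimage, if_true, Set.mem_Iic, Set.mem_union, Set.mem_inter_iff,
          true_and, Set.mem_compl_iff, not_true_eq_false, false_and, or_false, hT hclosed]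
        constructor
        · intro h
          obtain ⟨z, hz, hz1⟩ := hsmem hp
          exact ⟨z, ⟨hz.1, hz1.trans_le h⟩, hz.2⟩
        · rintro ⟨z, hz, hzp⟩
          exact (csInf_le (hs p).bddBelow ⟨z, ⟨hz.1, hzp⟩, rfl⟩).trans hz.2
      · simp [t, hp]
    rw [heq]
    exact ((hTm _).inter (hTm _)).union ((hTm _).compl.inter (MeasurableSet.const _))
  refine ⟨fun p => !₂[g (t p), t p], ?_, fun p hp => ?_⟩
  · refine (PiLp.continuous_toLp 2 _).measurable.comp (measurable_pi_iff.2 fun i => ?_)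
    fin_cases i
    · exact hg.comp ht
    · exact ht
  · obtain ⟨y, hy, hpy⟩ := hF.exists_infDist_eq_dist hne p
    have hpT : p ∈ T F := (hT hF).2 ⟨y, hy, by rwa [dist_comm, ← hpy]⟩
    obtain ⟨z, hz, hz1⟩ := hsmem hpT
    have htp : t p = z 1 := by simp only [t, hpT, if_true, ← hz1]
    have hzeq : (!₂[g (t p), t p] : Plane) = z := by
      ext i
      fin_cases i
      · simp [htp, hFg z hz.1]
      · simp [htp]
    simp only [hzeq]
    exact ⟨hz.1, hz.2⟩

lemma frontier_powerDomain_subset {A γ : ℝ} (hA : 0 < A) (hγ : 0 < γ) {z : Plane}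
    (hz : z ∈ frontier (powerDomain A γ : Set Plane)) : z 0 = (|z 1| / A) ^ γ⁻¹ := by
  have hclosed : IsClosed {z : Plane | 0 ≤ z 0 ∧ |z 1| ≤ A * z 0 ^ γ} := by
    have h0 : Continuous fun z : Plane => z 0 := by fun_prop
    have h1 : Continuous fun z : Plane => |z 1| := by fun_prop
    exact (isClosed_le continuous_const h0).inter
      (isClosed_le h1 (continuous_const.mul ((Real.continuous_rpow_const hγ.le).comp h0)))
  rw [(powerDomain A γ).isOpen.frontier_eq] at hz
  obtain ⟨h0, h1⟩ : 0 ≤ z 0 ∧ |z 1| ≤ A * z 0 ^ γ :=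
    hclosed.closure_subset_iff.2 (fun w hw => ⟨hw.1.le, hw.2.le⟩) hz.1
  have heq : |z 1| = A * z 0 ^ γ := by
    rcases h0.eq_or_lt with h | h
    · rw [← h, Real.zero_rpow hγ.ne', mul_zero] at h1 ⊢
      exact le_antisymm h1 (abs_nonneg _)
    · exact le_antisymm h1 (not_lt.1 fun hlt => hz.2 ⟨h, hlt⟩)
  rw [heq, mul_div_cancel_left₀ _ hA.ne', Real.rpow_rpow_inv h0 hγ.ne']

lemma exists_measurable_exit {A γ : ℝ} (hA : 0 < A) (hγ : 0 < γ) {r : ℝ} (hr : 0 ≤ r) :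
    ∃ e : Plane → Plane, Measurable e ∧ ∀ p ∈ powerDomain A γ,
      Metric.infDist p (frontier (powerDomain A γ : Set Plane)) ≤ r →
      e p ∈ frontier (powerDomain A γ : Set Plane) ∧ dist (e p) p ≤ r := by
  have hne : (frontier (powerDomain A γ : Set Plane)).Nonempty := by
    refine nonempty_frontier_iff.2 ⟨⟨!₂[1, 0], ?_⟩, fun h => ?_⟩
    · change (0 : ℝ) < 1 ∧ |(0 : ℝ)| < A * 1 ^ γ
      simp [hA]
    · have h0 : (0 : Plane) ∈ (powerDomain A γ : Set Plane) := h ▸ Set.mem_univ _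
      exact lt_irrefl _ h0.1
  obtain ⟨e, he, h⟩ := exists_measurable_selection isClosed_frontier hne
    (g := fun y => (|y| / A) ^ γ⁻¹) (by fun_prop)
    (fun z hz => frontier_powerDomain_subset hA hγ hz) hr
  exact ⟨e, he, fun p _ => h p⟩

/-! ### The quadratic supersolution -/

/-- The quadratic supersolution. -/
def potential (N B : ℝ) (p : Plane) : ℝ := (p 0 + N) ^ 2 - B * p 1 ^ 2

/-- The gradient of `potential N B`. -/
def potentialGrad (N B : ℝ) (p : Plane) : Plane := !₂[2 * (p 0 + N), -(2 * B * p 1)]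

lemma continuous_potential (N B : ℝ) : Continuous (potential N B) := by
  unfold potential
  fun_prop

lemma measurable_potentialGrad (N B : ℝ) : Measurable (potentialGrad N B) := by
  refine (PiLp.continuous_toLp 2 _).measurable.comp (measurable_pi_iff.2 fun i => ?_)
  fin_cases i
  · exact Measurable.const_mul (by fun_prop) _
  · exact (Measurable.const_mul (by fun_prop) _).neg

/-- The total displacement is `(1 + w 0) v + w 1 v^⊥`, where `E (1 + w 0)^2 = 1 + C₁₁`, `E (w 1)^2 =
C₂₂`, and the mixed moment vanishes. There is no Taylor remainder, as the potential is quadratic. -/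
lemma integral_potential [IsProbabilityMeasure μ] (hμ : IsNoiseMeasure μ) (N B : ℝ) (p v : Plane) :
    Integrable (fun w => potential N B (p + v + Psi v w)) μ ∧
    ∫ w, potential N B (p + v + Psi v w) ∂μ = potential N B p + inner ℝ (potentialGrad N B p) v
      + (v 0 ^ 2 - B * v 1 ^ 2) * (1 + cov μ 0 0) + (v 1 ^ 2 - B * v 0 ^ 2) * cov μ 1 1 := by
  have hinner : inner ℝ (potentialGrad N B p) v = 2 * (p 0 + N) * v 0 - 2 * B * p 1 * v 1 := by
    simp [potentialGrad, PiLp.inner_apply, Fin.sum_univ_two]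
    ring
  have h : (fun w => potential N B (p + v + Psi v w)) = fun w : Plane =>
      (potential N B p + 2 * (p 0 + N) * v 0 - 2 * B * p 1 * v 1 + (v 0 ^ 2 - B * v 1 ^ 2)) +
      (2 * (p 0 + N) * v 0 - 2 * B * p 1 * v 1 + 2 * (v 0 ^ 2 - B * v 1 ^ 2)) * w 0 +
      (-(2 * (p 0 + N) * v 1) - 2 * B * p 1 * v 0 - 2 * (1 + B) * (v 0 * v 1)) * w 1 +
      (v 0 ^ 2 - B * v 1 ^ 2) * (w 0 * w 0) + (v 1 ^ 2 - B * v 0 ^ 2) * (w 1 * w 1) +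
      (-(2 * (1 + B) * (v 0 * v 1))) * (w 0 * w 1) := by
    funext w
    simp only [potential, Psi, PiLp.add_apply, PiLp.smul_apply, smul_eq_mul, Matrix.cons_val_zero,
      Matrix.cons_val_one, Matrix.cons_val_fin_one]
    ring
  rw [h]
  refine ⟨(hμ.integral_quadratic _ _ _ _ _ _).1, ?_⟩
  rw [(hμ.integral_quadratic _ _ _ _ _ _).2, hinner]
  ring

/-- The conditions on `B` make both second-order coefficients, `1 + C₁₁ - B C₂₂` of `v 0 ^ 2` and
`C₂₂ - B (1 + C₁₁)` of `v 1 ^ 2`, at most `-1`. -/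
lemma integral_potential_le [IsProbabilityMeasure μ] (hμ : IsNoiseMeasure μ) {B : ℝ}
    (hB₁ : 2 + cov μ 0 0 ≤ B * cov μ 1 1) (hB₂ : 1 + cov μ 1 1 ≤ B) (N : ℝ) (p v : Plane) :
    ∫ w, potential N B (p + v + Psi v w) ∂μ ≤
      potential N B p + inner ℝ (potentialGrad N B p) v - ‖v‖ ^ 2 := by
  rw [(integral_potential hμ N B p v).2, EuclideanSpace.real_norm_sq_eq, Fin.sum_univ_two]
  have h0 := cov_self_nonneg μ 0
  have h1 := cov_self_nonneg μ 1
  have hB : 1 + cov μ 1 1 ≤ B * (1 + cov μ 0 0) := by nlinarith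
  nlinarith [mul_le_mul_of_nonneg_left hB₁ (sq_nonneg (v 0)),
    mul_le_mul_of_nonneg_left hB (sq_nonneg (v 1))]

lemma exists_potential_nonneg {A γ : ℝ} (hA : 0 < A) (hγ₀ : 0 < γ) (hγ₁ : γ < 1) {B : ℝ}
    (hB : 0 ≤ B) : ∃ N : ℝ, 0 ≤ N ∧ ∀ p ∈ powerDomain A γ, 0 ≤ potential N B p := by
  set K := √B * A
  have hK : 0 ≤ K := by positivity
  have hγ : 0 < 1 - γ := sub_pos.2 hγ₁
  -- Past `x = K ^ (1 - γ)⁻¹` one has `K x^γ ≤ x`; before it, `K x^γ` is at most its value at that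
  -- point, which is taken as `N`.
  refine ⟨K * (K ^ (1 - γ)⁻¹) ^ γ, by positivity, fun p ⟨hp0, hp1⟩ => ?_⟩
  set N := K * (K ^ (1 - γ)⁻¹) ^ γ
  have hN : 0 ≤ N := by positivity
  have hmain : K * p 0 ^ γ ≤ p 0 + N := by
    rcases le_total (p 0) (K ^ (1 - γ)⁻¹) with h | h
    · have := mul_le_mul_of_nonneg_left (Real.rpow_le_rpow hp0.le h hγ₀.le) hK
      linarith
    · have h2 : K ≤ p 0 ^ (1 - γ) := by
        have := Real.rpow_le_rpow (by positivity) h hγ.le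
        rwa [Real.rpow_inv_rpow hK hγ.ne'] at this
      have h3 := mul_le_mul_of_nonneg_right h2 (Real.rpow_nonneg hp0.le γ)
      rw [← Real.rpow_add hp0, sub_add_cancel, Real.rpow_one] at h3
      linarith
  have h4 : √B * |p 1| ≤ p 0 + N := by
    refine le_trans ?_ hmain
    rw [mul_assoc]
    exact mul_le_mul_of_nonneg_left hp1.le (Real.sqrt_nonneg B)
  have h5 := pow_le_pow_left₀ (by positivity) h4 2
  rw [mul_pow, Real.sq_sqrt hB, sq_abs] at h5
  exact sub_nonneg.2 h5

end

/-! ### The barrier and the strategy of player II -/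

section

open scoped Classical in
/-- The function `u + c` on `D`, continued by `0` to the frontier and by `∞` elsewhere. -/
def barrier (D : TopologicalSpace.Opens Plane) (u : Plane → ℝ) (c : ℝ) (p : Plane) : ℝ≥0∞ :=
  if p ∈ D then ENNReal.ofReal (u p + c) else if p ∈ frontier (D : Set Plane) then 0 else ⊤

lemma measurable_barrier {u : Plane → ℝ} (hu : Measurable u) (c : ℝ) :
    Measurable (barrier D u c) := by
  unfold barrier
  exact Measurable.ite D.isOpen.measurableSet (hu.add_const c).ennreal_ofReal
    (Measurable.ite isClosed_frontier.measurableSet measurable_const measurable_const)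

lemma barrier_of_mem {u : Plane → ℝ} {c : ℝ} {p : Plane} (hp : p ∈ D) :
    barrier D u c p = ENNReal.ofReal (u p + c) := if_pos hp

lemma not_mem_of_mem_frontier {p : Plane} (hp : p ∈ frontier (D : Set Plane)) : p ∉ D := by
  rw [D.isOpen.frontier_eq] at hp
  exact hp.2

lemma barrier_of_mem_frontier {u : Plane → ℝ} {c : ℝ} {p : Plane}
    (hp : p ∈ frontier (D : Set Plane)) : barrier D u c p = 0 := by
  rw [barrier, if_neg (not_mem_of_mem_frontier hp), if_pos hp]

lemma barrier_of_not_mem {u : Plane → ℝ} {c : ℝ} {p : Plane} (hp : p ∉ D)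
    (hpF : p ∉ frontier (D : Set Plane)) : barrier D u c p = ⊤ := by
  rw [barrier, if_neg hp, if_neg hpF]

lemma lintegral_barrier_turn_of_frontier_near (S : Strategy D μ ε) {u : Plane → ℝ}
    (hu : Measurable u) (c : ℝ) {n : ℕ} {h : History n} (hp : h.pos ∈ D)
    (hdist : Metric.infDist h.pos (frontier (D : Set Plane)) ≤ alpha μ * ε) :
    ∫⁻ z, barrier D u c z.2 ∂(S.turn n h) = 0 := by
  rw [Strategy.turn, if_pos hp, if_pos hdist,
    lintegral_dirac' (f := fun z : Plane × Plane => barrier D u c z.2) _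
      ((measurable_barrier hu c).comp measurable_snd)]
  exact barrier_of_mem_frontier (S.exit_mem n h hp hdist).1

variable [IsProbabilityMeasure μ]

/-- Move and noise together have length at most `(1 + ‖w‖) ε ≤ alpha μ * ε`, too short to reach the
frontier. -/
lemma ae_step_mem (hμ : IsNoiseMeasure μ) {p v : Plane} (hp : p ∈ D)
    (hdist : alpha μ * ε < Metric.infDist p (frontier (D : Set Plane))) (hv : ‖v‖ ≤ ε) :
    ∀ᵐ w ∂μ, p + v + Psi v w ∈ D := by
  filter_upwards [hμ.ae_norm_le] with w hw
  refine mem_of_dist_lt_infDist_frontier hp (lt_of_le_of_lt ?_ hdist)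
  rw [dist_eq_norm, add_assoc, add_sub_cancel_left]
  calc ‖v + Psi v w‖ ≤ ‖v‖ + ‖v‖ * ‖w‖ := (norm_add_le _ _).trans_eq (by rw [norm_Psi])
    _ = (1 + ‖w‖) * ‖v‖ := by ring
    _ ≤ alpha μ * ε := by
      refine mul_le_mul (by linarith) hv (norm_nonneg _) ?_
      linarith [one_le_alpha (μ := μ)]

lemma lintegral_barrier_turn_of_frontier_far (hμ : IsNoiseMeasure μ) (S : Strategy D μ ε)
    {u : Plane → ℝ} (hu : Measurable u) (hu0 : ∀ p ∈ D, 0 ≤ u p) {c : ℝ} (hc : 0 ≤ c) {n : ℕ}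
    {h : History n} (hp : h.pos ∈ D)
    (hdist : alpha μ * ε < Metric.infDist h.pos (frontier (D : Set Plane)))
    (hint : Integrable (fun w => u (h.pos + S.move n h + Psi (S.move n h) w)) μ) :
    0 ≤ ∫ w, u (h.pos + S.move n h + Psi (S.move n h) w) ∂μ ∧
    ∫⁻ z, barrier D u c z.2 ∂(S.turn n h) =
      ENNReal.ofReal (∫ w, u (h.pos + S.move n h + Psi (S.move n h) w) ∂μ + c) := by
  have hmem := ae_step_mem hμ hp hdist (S.norm_move_le n h)
  have hPsi : Measurable (Psi (S.move n h)) := measurable_Psi.comp measurable_prodMk_left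
  refine ⟨integral_nonneg_of_ae (by filter_upwards [hmem] with w hw using hu0 _ hw), ?_⟩
  rw [Strategy.turn, if_pos hp, if_neg (not_le.2 hdist), map_noiseAt,
    lintegral_map (f := fun z : Plane × Plane => barrier D u c z.2)
      ((measurable_barrier hu c).comp measurable_snd) (by fun_prop)]
  have hadd : ∫ w, u (h.pos + S.move n h + Psi (S.move n h) w) ∂μ + c =
      ∫ w, (u (h.pos + S.move n h + Psi (S.move n h) w) + c) ∂μ := by
    rw [integral_add hint (integrable_const c)]
    simp
  have hint' : Integrable (fun w => u (h.pos + S.move n h + Psi (S.move n h) w) + c) μ :=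
    hint.add (integrable_const c)
  rw [hadd, ofReal_integral_eq_lintegral_ofReal hint']
  · refine lintegral_congr_ae ?_
    filter_upwards [hmem] with w hw using barrier_of_mem hw
  · filter_upwards [hmem] with w hw using add_nonneg (hu0 _ hw) hc

/-- The barrier built from the quadratic supersolution decreases on average when player II pulls
against the gradient. -/
lemma barrier_drift (hμ : IsNoiseMeasure μ) (hε : 0 < ε) {B N : ℝ}
    (hB₁ : 2 + cov μ 0 0 ≤ B * cov μ 1 1) (hB₂ : 1 + cov μ 1 1 ≤ B)
    (hu0 : ∀ p ∈ D, 0 ≤ potential N B p) (hgrad : ∀ p ∈ D, potentialGrad N B p ≠ 0)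
    (S₁ S₂ : Strategy D μ ε)
    (hS₂ : ∀ n h, S₂.move n h =
      -(ε / ‖potentialGrad N B h.pos‖) • potentialGrad N B h.pos) (n : ℕ) (h : History n) :
    ∫⁻ z, barrier D (potential N B) (ε ^ 2 / 2) z.2 ∂(turnMeasure S₁ S₂ n h) +
      ENNReal.ofReal (ε ^ 2 / 2) *
        (frontier (D : Set Plane))ᶜ.indicator (fun _ => (1 : ℝ≥0∞)) h.pos ≤
      barrier D (potential N B) (ε ^ 2 / 2) h.pos := by
  have hu := (continuous_potential N B).measurable
  have hc : 0 ≤ ε ^ 2 / 2 := by positivity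
  by_cases hp : h.pos ∈ D
  · have hpF : h.pos ∈ (frontier (D : Set Plane))ᶜ := fun hF => not_mem_of_mem_frontier hF hp
    rw [Set.indicator_of_mem hpF, mul_one, barrier_of_mem hp, turnMeasure, lintegral_add_measure,
      lintegral_smul_measure, lintegral_smul_measure]
    rcases le_or_gt (Metric.infDist h.pos (frontier (D : Set Plane))) (alpha μ * ε) with hd | hd
    · rw [lintegral_barrier_turn_of_frontier_near S₁ hu _ hp hd,
        lintegral_barrier_turn_of_frontier_near S₂ hu _ hp hd]
      -- The game ends in this turn, and the added constant `ε ^ 2 / 2` alone pays for it, since `u`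
      -- may be arbitrarily small here.
      simp only [smul_zero, zero_add]
      exact ENNReal.ofReal_le_ofReal (le_add_of_nonneg_left (hu0 _ hp))
    · obtain ⟨h1, e1⟩ := lintegral_barrier_turn_of_frontier_far hμ S₁ hu hu0 hc hp hd
        (integral_potential hμ N B _ _).1
      obtain ⟨h2, e2⟩ := lintegral_barrier_turn_of_frontier_far hμ S₂ hu hu0 hc hp hd
        (integral_potential hμ N B _ _).1
      have b1 := integral_potential_le hμ hB₁ hB₂ N h.pos (S₁.move n h)
      have b2 := integral_potential_le hμ hB₁ hB₂ N h.pos (S₂.move n h)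
      have hg : 0 < ‖potentialGrad N B h.pos‖ := norm_pos_iff.2 (hgrad _ hp)
      have hi1 : inner ℝ (potentialGrad N B h.pos) (S₁.move n h) ≤
          ‖potentialGrad N B h.pos‖ * ε :=
        (real_inner_le_norm _ _).trans (mul_le_mul_of_nonneg_left (S₁.norm_move_le n h) hg.le)
      have hi2 : inner ℝ (potentialGrad N B h.pos) (S₂.move n h) =
          -(‖potentialGrad N B h.pos‖ * ε) := by
        rw [hS₂, real_inner_smul_right, real_inner_self_eq_norm_sq]
        field_simp
      have hn2 : ‖S₂.move n h‖ = ε := by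
        rw [hS₂, norm_smul, norm_neg, Real.norm_of_nonneg (by positivity)]
        field_simp
      rw [hi2, hn2] at b2
      have half : (2⁻¹ : ℝ≥0∞) = ENNReal.ofReal 2⁻¹ := by
        rw [ENNReal.ofReal_inv_of_pos two_pos, ENNReal.ofReal_ofNat]
      rw [e1, e2, half, smul_eq_mul, smul_eq_mul, ← ENNReal.ofReal_mul (by norm_num),
        ← ENNReal.ofReal_mul (by norm_num), ← ENNReal.ofReal_add (by positivity) (by positivity),
        ← ENNReal.ofReal_add (by positivity) hc]
      refine ENNReal.ofReal_le_ofReal ?_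
      -- In the average of `b1` and `b2` the terms `± ‖∇u‖ ε` cancel; player II's own `-ε ^ 2` is
      -- halved to the required drift.
      linarith [sq_nonneg ‖S₁.move n h‖]
  · by_cases hpF : h.pos ∈ frontier (D : Set Plane)
    · have hturn : turnMeasure S₁ S₂ n h = Measure.dirac (0, h.pos) := by
        rw [turnMeasure, Strategy.turn, Strategy.turn, if_neg hp, if_neg hp, ← add_smul,
          ENNReal.inv_two_add_inv_two, one_smul]
      rw [hturn, lintegral_dirac'
        (f := fun z : Plane × Plane => barrier D (potential N B) (ε ^ 2 / 2) z.2) _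
        ((measurable_barrier hu _).comp measurable_snd),
        Set.indicator_of_notMem (Set.notMem_compl_iff.2 hpF)]
      simp
    -- Positions outside the closure are made harmless by the value `⊤`.
    · rw [barrier_of_not_mem hp hpF]
      exact le_top

/-- Player II pulls against the gradient of the quadratic supersolution. -/
def gradientStrategy (hε : 0 ≤ ε) (N B : ℝ) {e : Plane → Plane} (he : Measurable e)
    (hexit : ∀ p ∈ D, Metric.infDist p (frontier (D : Set Plane)) ≤ alpha μ * ε →
      e p ∈ frontier (D : Set Plane) ∧ dist (e p) p ≤ alpha μ * ε) : Strategy D μ ε where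
  move _ h := -(ε / ‖potentialGrad N B h.pos‖) • potentialGrad N B h.pos
  measurable_move n := by
    have h := (measurable_potentialGrad N B).comp (measurable_pos n)
    exact (h.norm.const_div ε).neg.smul h
  norm_move_le n h := by
    rw [norm_smul, norm_neg, Real.norm_of_nonneg (by positivity)]
    -- At a zero of the gradient, division by zero makes the move `0`, which is still legal.
    rcases eq_or_ne ‖potentialGrad N B h.pos‖ 0 with h0 | h0
    · rwa [h0, mul_zero]
    · rw [div_mul_cancel₀ _ h0]
  exit _ h := e h.pos
  measurable_exit n := he.comp (measurable_pos n)
  exit_mem _ h := hexit h.pos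

end

end TugOfWar

end

/-! ### The uniform bound -/

theorem corollary1p6 (μ : MeasureTheory.Measure TugOfWar.Plane)
    [MeasureTheory.IsProbabilityMeasure μ]
    (hμ : TugOfWar.IsNoiseMeasure μ) (hC : 0 < TugOfWar.cov μ 1 1)
    (A γ : ℝ) (hA : 0 < A) (hγ₀ : 0 < γ) (hγ₁ : γ < 1) :
    ∃ ε₀ : ℝ, 0 < ε₀ ∧
      ∃ S₂ : (ε : Set.Ioo (0 : ℝ) ε₀) → TugOfWar.Strategy (TugOfWar.powerDomain A γ) μ ε,
        ∀ x₀ ∈ TugOfWar.powerDomain A γ,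
          (⨆ (S₁ : (ε : Set.Ioo (0 : ℝ) ε₀) → TugOfWar.Strategy (TugOfWar.powerDomain A γ) μ ε)
            (ε : Set.Ioo (0 : ℝ) ε₀),
              ENNReal.ofReal ((ε : ℝ) ^ 2) * TugOfWar.expectedTime (S₁ ε) (S₂ ε) x₀) < ⊤ := by
  set B : ℝ := max ((2 + TugOfWar.cov μ 0 0) / TugOfWar.cov μ 1 1) (1 + TugOfWar.cov μ 1 1)
  have hB₁ : 2 + TugOfWar.cov μ 0 0 ≤ B * TugOfWar.cov μ 1 1 :=
    (div_le_iff₀ hC).1 (le_max_left _ _)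
  have hB₂ : 1 + TugOfWar.cov μ 1 1 ≤ B := le_max_right _ _
  obtain ⟨N, hN, hu0⟩ := TugOfWar.exists_potential_nonneg hA hγ₀ hγ₁
    (B := B) (by linarith)
  have hgrad : ∀ p ∈ TugOfWar.powerDomain A γ, TugOfWar.potentialGrad N B p ≠ 0 := by
    intro p hp h
    have h0 : 2 * (p 0 + N) = 0 := congrArg (fun q : TugOfWar.Plane => q 0) h
    linarith [hp.1]
  have hα : 0 ≤ TugOfWar.alpha μ := zero_le_one.trans TugOfWar.one_le_alpha
  choose e he hexit using fun ε : Set.Ioo (0 : ℝ) 1 =>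
    TugOfWar.exists_measurable_exit hA hγ₀ (mul_nonneg hα ε.2.1.le)
  -- The drift estimate holds for every step size, so `1` is an arbitrary choice; it only bounds the
  -- added constant `ε ^ 2 / 2` by `1`.
  refine ⟨1, one_pos, fun ε => TugOfWar.gradientStrategy ε.2.1.le N B (he ε) (hexit ε),
    fun x₀ hx₀ => ?_⟩
  refine lt_of_le_of_lt (b := 2 * ENNReal.ofReal (TugOfWar.potential N B x₀ + 1))
    (iSup₂_le fun S₁ ε => ?_) (ENNReal.mul_lt_top (by simp) ENNReal.ofReal_lt_top)
  obtain ⟨ε, hε₀, hε₁⟩ := ε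
  have h := TugOfWar.expectedTime_le_of_drift (S₁ ⟨ε, hε₀, hε₁⟩) _ x₀
    (TugOfWar.measurable_barrier (TugOfWar.continuous_potential N B).measurable (ε ^ 2 / 2))
    (ENNReal.ofReal (ε ^ 2 / 2))
    (TugOfWar.barrier_drift hμ hε₀ hB₁ hB₂ hu0 hgrad _
      (TugOfWar.gradientStrategy hε₀.le N B (he ⟨ε, hε₀, hε₁⟩) (hexit ⟨ε, hε₀, hε₁⟩))
      fun _ _ => rfl)
  rw [TugOfWar.barrier_of_mem hx₀] at h
  have h2 : ENNReal.ofReal (ε ^ 2) = 2 * ENNReal.ofReal (ε ^ 2 / 2) := by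
    rw [← ENNReal.ofReal_ofNat 2, ← ENNReal.ofReal_mul (by norm_num)]
    congr 1
    ring
  rw [h2, mul_assoc]
  refine mul_le_mul_right (h.trans (ENNReal.ofReal_le_ofReal ?_)) _
  nlinarith
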